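/- Let $\mathscr H$ be a complex separable Hilbert space. For $p>0$ let $\mathbb B_p(\mathscr H)$ be the Schatten class of compact operators $X$ on $\mathscr H$ with $\operatorname{tr}|X|^p<\infty$, where $|X|=(X^*X)^{1/2}$, and put $\|X\|_p=(\operatorname{tr}|X|^p)^{1/p}$. Let $1<p\le 2$ and $\frac1p+\frac1q=1$. Let $A_1,\dots,A_n\in\mathbb B_p(\mathscr H)$, and put $B=\sum_{k=1}^n A_k$ and $B_{i,j}=A_i-A_j$ for $1\le i<j\le n$. Let $Y$ and $Y_{i,j}$ ($1\le i<j\le n$) be operators in $\mathbb B_q(\mathscr H)$. Then $YB+\sum_{1\le i<j\le n}Y_{i,j}B_{i,j}$ is a trace class operator (that is, it lies in $\mathbb B_1(\mathscr H)$) and $$\Bigl|\operatorname{tr}\Bigl(YB+\sum_{1\le i<j\le n}Y_{i,j}B_{i,j}\Bigr)\Bigr|\le n^{1/q}\Bigl(\sum_{k=1}^n\|A_k\|_p^p\Bigr)^{1/p}\Bigl(\|Y\|_q^p+\sum_{1\le i<j\le n}\|Y_{i,j}\|_q^p\Bigr)^{1/p}.$$ -/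

import Mathlib

open scoped InnerProductSpace

noncomputable section

namespace Schatten

variable {H : Type*} [NormedAddCommGroup H] [InnerProductSpace ℂ H] [CompleteSpace H]

/-- The index set of a fixed orthonormal (Hilbert) basis of `H`. -/
def basisIndex (H : Type*) [NormedAddCommGroup H] [InnerProductSpace ℂ H] [CompleteSpace H] :
    Set H :=
  (exists_hilbertBasis ℂ H).choose

/-- A fixed orthonormal (Hilbert) basis of `H`. -/
def basis (H : Type*) [NormedAddCommGroup H] [InnerProductSpace ℂ H] [CompleteSpace H] :
    HilbertBasis (basisIndex H) ℂ H :=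
  (exists_hilbertBasis ℂ H).choose_spec.choose

/-- The trace `∑ ⟨e, T e⟩ ∈ [0, ∞]` of a positive bounded operator `T`, the sum being over an
orthonormal basis (the value is the same for all bases). -/
def posTrace (T : H →L[ℂ] H) : ENNReal :=
  ∑' e : basisIndex H, ENNReal.ofReal (⟪basis H e, T (basis H e)⟫_ℂ).re

/-- The usual trace `tr T = ∑ ⟨e, T e⟩` of a trace class operator `T`, the sum being over an
orthonormal basis. For trace class operators the sum converges absolutely and has the same
value for all bases. -/
def trace (T : H →L[ℂ] H) : ℂ :=
  ∑' e : basisIndex H, ⟪basis H e, T (basis H e)⟫_ℂ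

/-- `X` belongs to the Schatten class `𝔹_p(H)`: it is compact and `tr |X|^p < ∞`, where
`|X| = (X* X)^{1/2}` and powers of positive operators are given by functional calculus. -/
def Mem (p : ℝ) (X : H →L[ℂ] H) : Prop :=
  IsCompactOperator X ∧ posTrace (CFC.abs X ^ p) < ⊤

/-- The Schatten norm `‖X‖_p = (tr |X|^p)^{1/p}`, for `X` in the Schatten class `𝔹_p(H)`. -/
def norm (p : ℝ) (X : H →L[ℂ] H) : ℝ :=
  (posTrace (CFC.abs X ^ p)).toReal ^ (1 / p)

end Schatten

end

set_option linter.unusedSectionVars false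

noncomputable section

namespace Schatten

universe u

open Filter Topology

open scoped TensorProduct

variable {H : Type u} [NormedAddCommGroup H] [InnerProductSpace ℂ H] [CompleteSpace H]

/-! The operator in question is `∑ εₖₐ Yₐ Aₖ`, where the index `a` stands for the full sum or for a
pair `i < j`, and `εₖₐ` is the coefficient of `Aₖ` in the sum or in the difference. Entries of `ε`
have modulus at most one, and its rows are orthogonal of squared length `n`
(`sum_clarksonCoeff_mul`). Only these two facts about `ε` enter the estimate, which is complex
interpolation between two endpoints. At `(1, ∞)`, `|tr(Yₐ Aₖ)| ≤ ‖Yₐ‖ ‖Aₖ‖₁` and the bound on the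
entries suffice (`norm_pairing_le_one`). At `(2, 2)`, the trace is a Hilbert–Schmidt inner product,
and Cauchy–Schwarz with orthogonality of the rows gives the factor `√n` (`norm_pairing_le_two`). The
three lines theorem at `θ = 2 / q` joins them (`norm_pairing_le`). Interpolation is done on finite
truncations of singular value decompositions, where everything is a finite sum of exponentials. The
limit is justified by writing each `Yₐ Aₖ` as an absolutely convergent series of rank one operators
(`Schmidt.nuclearRep_mul`), which also yields membership in the trace class. -/

/-! ### Eigenbases and singular value decompositions of compact operators. -/

/-- The functions for which the claim holds contain the constants and the identity and are closed
under sums, products and uniform limits, so Stone–Weierstrass applies. -/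
theorem cfc_apply_eigenvector {T : H →L[ℂ] H} (hT : IsSelfAdjoint T) {f : ℝ → ℝ}
    (hf : ContinuousOn f (spectrum ℝ T)) {μ : ℝ} {v : H} (hv : v ≠ 0) (h : T v = (μ : ℂ) • v) :
    cfc f T v = (f μ : ℂ) • v := by
  have hμ : μ ∈ spectrum ℝ T := by
    rw [spectrum.mem_iff]
    intro hu
    obtain ⟨S, hS⟩ := hu.exists_left_inv
    have h0 : (algebraMap ℝ (H →L[ℂ] H) μ - T) v = 0 := by
      simp [Algebra.algebraMap_eq_smul_one, h]
    have := congrArg (fun R : H →L[ℂ] H => R v) hS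
    simp only [mul_apply_eq_comp, h0, map_zero, one_apply_eq_self] at this
    exact hv this.symm
  have key : ∀ g : C(spectrum ℝ T, ℝ), cfcHom hT g v = (g ⟨μ, hμ⟩ : ℂ) • v := by
    intro g
    induction g using ContinuousMap.induction_on_of_compact with
    | const r =>
      have : ContinuousMap.const (spectrum ℝ T) r = algebraMap ℝ _ r := rfl
      rw [this, AlgHomClass.commutes]
      simp [Algebra.algebraMap_eq_smul_one]
    | id =>
      rw [cfcHom_id hT]
      simpa using h
    | star_id =>
      rw [map_star, cfcHom_id hT, hT.star_eq]
      simpa using h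
    | add f g hf hg => simp [map_add, hf, hg, add_smul]
    | mul f g hf hg =>
      rw [map_mul, mul_apply_eq_comp, hg, map_smul, hf, smul_smul, ContinuousMap.mul_apply,
        Complex.ofReal_mul, mul_comm]
    | frequently f hf =>
      refine IsClosed.mem_of_frequently_of_tendsto (f := id) (b := nhds f)
        (s := {g : C(spectrum ℝ T, ℝ) | cfcHom hT g v = (g ⟨μ, hμ⟩ : ℂ) • v}) ?_ hf Filter.tendsto_id
      refine isClosed_eq ?_ ?_
      · exact (ContinuousLinearMap.apply ℂ H v).continuous.comp (cfcHom_continuous hT)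
      · exact ((Complex.continuous_ofReal.comp
          (continuous_eval_const (⟨μ, hμ⟩ : spectrum ℝ T)))).smul continuous_const
  rw [cfc_apply f T hT hf, key]
  rfl

/-- Hilbert bases of all eigenspaces, kernel included, are glued together; by the spectral theorem
nothing nonzero is orthogonal to every eigenspace. -/
theorem exists_hilbertBasis_eigenvectors {T : H →L[ℂ] H} (hT : IsCompactOperator T)
    (hT' : T.IsSymmetric) :
    ∃ (ι : Type u) (b : HilbertBasis ι ℂ H) (μ : ι → ℂ), ∀ i, T (b i) = μ i • b i := by
  have hc : ∀ μ : ℂ, IsClosed (Module.End.eigenspace (T : Module.End ℂ H) μ : Set H) := by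
    intro μ
    have : (Module.End.eigenspace (T : Module.End ℂ H) μ : Set H) = {x | T x = μ • x} := by
      ext x; simp
    rw [this]
    exact isClosed_eq T.continuous (continuous_const_smul μ)
  have hcs : ∀ μ : ℂ, CompleteSpace (Module.End.eigenspace (T : Module.End ℂ H) μ) :=
    fun μ => (hc μ).completeSpace_coe
  choose w b hb using fun μ : ℂ =>
    exists_hilbertBasis ℂ (Module.End.eigenspace (T : Module.End ℂ H) μ)
  have ho := hT'.orthogonalFamily_eigenspaces.orthonormal_sigma_orthonormal
    (v_family := fun μ => b μ) (fun μ => (b μ).orthonormal)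
  refine ⟨Σ μ : ℂ, w μ, HilbertBasis.mkOfOrthogonalEqBot ho ?_, fun a => a.1, ?_⟩
  · rw [eq_bot_iff, ← T.orthogonalComplement_iSup_eigenspaces_eq_bot hT hT']
    intro x hx
    rw [← Submodule.iInf_orthogonal, Submodule.mem_iInf]
    intro μ
    rw [Submodule.mem_orthogonal]
    intro u hu
    have h1 := (b μ).hasSum_repr ⟨u, hu⟩
    have h2 := (h1.mapL (Submodule.subtypeL _)).mapL (innerSL ℂ x)
    have h3 : inner ℂ x u = 0 := by
      refine h2.unique ?_
      convert! hasSum_zero using 2 with i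
      have : ⟪x, ((b μ i : Module.End.eigenspace (T : Module.End ℂ H) μ) : H)⟫_ℂ = 0 :=
        (Submodule.mem_orthogonal' _ _).1 hx _ (Submodule.subset_span ⟨⟨μ, i⟩, rfl⟩)
      simp [this]
    rw [← inner_conj_symm, h3, map_zero]
  · intro i
    rw [HilbertBasis.coe_mkOfOrthogonalEqBot]
    exact Module.End.mem_eigenspace_iff.1 (b i.1 i.2).2

/-- A singular value (Schmidt) decomposition `X x = ∑ sᵢ ⟨vᵢ, x⟩ fᵢ` of an operator. -/
structure Schmidt (X : H →L[ℂ] H) where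
  ι : Type u
  s : ι → ℝ
  v : ι → H
  f : ι → H
  s_pos : ∀ i, 0 < s i
  v_orthonormal : Orthonormal ℂ v
  f_orthonormal : Orthonormal ℂ f
  hasSum : ∀ x, HasSum (fun i => ((s i : ℂ) * ⟪v i, x⟫_ℂ) • f i) (X x)
  posTrace_rpow : ∀ p : ℝ, 0 < p →
    posTrace (CFC.abs X ^ p) = ∑' i, ENNReal.ofReal (s i ^ p)

theorem abs_rpow (X : H →L[ℂ] H) {p : ℝ} (hp : 0 < p) :
    CFC.abs X ^ p = cfc (fun x : ℝ => x ^ (p / 2)) (star X * X) := by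
  have h0 : 0 ≤ star X * X := star_mul_self_nonneg X
  rw [CFC.abs, CFC.sqrt_eq_rpow, CFC.rpow_rpow_of_exponent_nonneg _ _ _ (by norm_num) hp.le,
    CFC.rpow_eq_cfc_real]
  congr! 3
  ring

/-- Tonelli and Parseval: this transfers the trace from the fixed basis to an eigenbasis. -/
theorem posTrace_of_eigenbasis {T : H →L[ℂ] H} {ι : Type u} (b : HilbertBasis ι ℂ H) (μ : ι → ℝ)
    (hμ : ∀ i, 0 ≤ μ i) (h : ∀ i, T (b i) = (μ i : ℂ) • b i) :
    posTrace T = ∑' i, ENNReal.ofReal (μ i) := by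
  have h1 : ∀ x, HasSum (fun i => μ i * ‖⟪b i, x⟫_ℂ‖ ^ 2) (⟪x, T x⟫_ℂ).re := by
    intro x
    have := ((b.hasSum_repr x).mapL T).mapL (innerSL ℂ x)
    have := Complex.hasSum_re this
    convert! this using 2 with i
    simp only [map_smul, h, innerSL_apply_apply, HilbertBasis.repr_apply_apply,
      smul_eq_mul]
    rw [mul_left_comm, Complex.re_ofReal_mul, ← inner_conj_symm x, Complex.mul_conj,
      Complex.normSq_eq_norm_sq, Complex.ofReal_re]
  unfold posTrace
  have h3 : ∀ e : basisIndex H, ENNReal.ofReal (⟪basis H e, T (basis H e)⟫_ℂ).re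
      = ∑' i, ENNReal.ofReal (μ i) * ENNReal.ofReal (‖⟪basis H e, b i⟫_ℂ‖ ^ 2) := by
    intro e
    rw [← (h1 _).tsum_eq, ENNReal.ofReal_tsum_of_nonneg (fun i => mul_nonneg (hμ i) (by positivity))
      (h1 _).summable]
    simp_rw [ENNReal.ofReal_mul (hμ _), norm_inner_symm (𝕜 := ℂ)]
  simp_rw [h3]
  rw [ENNReal.tsum_comm]
  congr 1 with i
  rw [ENNReal.tsum_mul_left]
  have h4 : HasSum (fun e => ‖⟪basis H e, b i⟫_ℂ‖ ^ 2) 1 := by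
    have := Complex.hasSum_re ((basis H).hasSum_inner_mul_inner (b i) (b i))
    rw [inner_self_eq_norm_sq_to_K, b.orthonormal.1 i] at this
    convert! this using 2 with e
    · rw [← inner_conj_symm (b i), mul_comm, Complex.mul_conj,
        Complex.normSq_eq_norm_sq, Complex.ofReal_re]
    · simp
  rw [← ENNReal.ofReal_tsum_of_nonneg (fun e => by positivity) h4.summable, h4.tsum_eq]
  simp

/-- `X` maps an eigenbasis of `X* X` to an orthogonal family. Dropping the vectors killed by `X` and
normalizing the images gives the decomposition. -/
theorem exists_schmidt {X : H →L[ℂ] H} (hX : IsCompactOperator X) : Nonempty (Schmidt X) := by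
  have hsa : IsSelfAdjoint (star X * X) := IsSelfAdjoint.star_mul_self X
  have hc : IsCompactOperator (star X * X) := hX.clm_comp (star X)
  obtain ⟨ι, b, μ, hb⟩ := exists_hilbertBasis_eigenvectors hc hsa.isSymmetric
  have hin : ∀ i j, ⟪X (b i), X (b j)⟫_ℂ = μ j * ⟪b i, b j⟫_ℂ := by
    intro i j
    rw [← ContinuousLinearMap.adjoint_inner_right, ← ContinuousLinearMap.star_eq_adjoint,
      ← mul_apply_eq_comp, hb, inner_smul_right]
  have hμ : ∀ i, μ i = ((‖X (b i)‖ ^ 2 : ℝ) : ℂ) := by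
    intro i
    have := hin i i
    rw [inner_self_eq_norm_sq_to_K, inner_self_eq_norm_sq_to_K, b.orthonormal.1 i] at this
    simpa using this.symm
  have hpow : ∀ p : ℝ, 0 < p → ∀ i, (CFC.abs X ^ p) (b i) = ((‖X (b i)‖ ^ p : ℝ) : ℂ) • b i := by
    intro p hp i
    rw [abs_rpow X hp, cfc_apply_eigenvector hsa (μ := ‖X (b i)‖ ^ 2) _
      (b.orthonormal.ne_zero i) (by rw [hb, hμ])]
    · rw [← Real.rpow_natCast, ← Real.rpow_mul (norm_nonneg _)]
      congr 4
      push_cast; ring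
    · exact (Real.continuous_rpow_const (by positivity)).continuousOn
  let κ := {i // X (b i) ≠ 0}
  have hpos : ∀ i : κ, 0 < ‖X (b i)‖ := fun i => norm_pos_iff.2 i.2
  refine ⟨{
    ι := κ
    s := fun i => ‖X (b i)‖
    v := fun i => b i
    f := fun i => ((‖X (b i)‖ : ℂ)⁻¹) • X (b i)
    s_pos := hpos
    v_orthonormal := b.orthonormal.comp _ Subtype.val_injective
    f_orthonormal := ?_
    hasSum := ?_
    posTrace_rpow := ?_ }⟩
  · classical
    rw [orthonormal_iff_ite]
    intro i j
    have h1 := (orthonormal_iff_ite.1 b.orthonormal) i j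
    rw [inner_smul_left, inner_smul_right, hin, h1, hμ]
    by_cases hij : i = j
    · subst hij
      have : (‖X (b i)‖ : ℂ) ≠ 0 := by exact_mod_cast (hpos i).ne'
      simp
      field_simp
    · rw [if_neg hij, if_neg (fun h => hij (Subtype.ext h))]
      simp
  · intro x
    have h1 := (b.hasSum_repr x).mapL X
    rw [← hasSum_subtype_iff_of_support_subset (s := {i | X (b i) ≠ 0})] at h1
    · refine HasSum.congr_fun (g := _) h1 fun i : κ => ?_
      have : (‖X (b i)‖ : ℂ) ≠ 0 := by exact_mod_cast (hpos i).ne'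
      simp only [Function.comp_apply, map_smul, HilbertBasis.repr_apply_apply, smul_smul]
      congr 1
      field_simp
    · intro i hi h0
      apply hi
      simp [h0]
  · intro p hp
    rw [posTrace_of_eigenbasis b (fun i => ‖X (b i)‖ ^ p) (fun i => by positivity) (hpow p hp)]
    symm
    refine tsum_subtype_eq_of_support_subset (s := {i | X (b i) ≠ 0})
      (f := fun i => ENNReal.ofReal (‖X (b i)‖ ^ p)) ?_
    intro i hi h0
    apply hi
    simp [h0, Real.zero_rpow hp.ne']

/-! ### Nuclear representations and the trace. -/

theorem sum_norm_inner_mul_le {κ : Type*} {w x : κ → H} (hw : Orthonormal ℂ w)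
    (hx : Orthonormal ℂ x) (F : Finset κ) (a b : H) :
    ∑ i ∈ F, ‖⟪a, x i⟫_ℂ‖ * ‖⟪w i, b⟫_ℂ‖ ≤ ‖a‖ * ‖b‖ := by
  refine (Real.sum_mul_le_sqrt_mul_sqrt _ _ _).trans ?_
  gcongr
  · simp_rw [norm_inner_symm a]
    exact Real.sqrt_le_iff.2 ⟨norm_nonneg _, hx.sum_inner_products_le a⟩
  · exact Real.sqrt_le_iff.2 ⟨norm_nonneg _, hw.sum_inner_products_le b⟩

/-- A series `∑ ⟨aᵢ, ·⟩ bᵢ` of rank one operators, with `∑ ‖aᵢ‖ ‖bᵢ‖ < ∞`, representing `T`. -/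
def NuclearRep {ι : Type*} (T : H →L[ℂ] H) (a b : ι → H) : Prop :=
  (Summable fun i => ‖a i‖ * ‖b i‖) ∧ ∀ x, HasSum (fun i => ⟪a i, x⟫_ℂ • b i) (T x)

/-- The sums `∑ |⟨wᵢ, T xᵢ⟩|` over pairs of orthonormal families are bounded by `C`. -/
def TraceBound (T : H →L[ℂ] H) (C : ℝ) : Prop :=
  ∀ ⦃κ : Type u⦄ (w x : κ → H), Orthonormal ℂ w → Orthonormal ℂ x → ∀ F : Finset κ,
    ∑ i ∈ F, ‖⟪w i, T (x i)⟫_ℂ‖ ≤ C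

/-- Each rank one term is handled by Cauchy–Schwarz and Bessel. Such bounds, unlike singular values,
add up at once; they control both the convergence of the trace and `∑ sᵢ`. -/
theorem NuclearRep.traceBound {ι : Type*} {T : H →L[ℂ] H} {a b : ι → H}
    (h : NuclearRep T a b) : TraceBound T (∑' i, ‖a i‖ * ‖b i‖) := by
  intro κ w x hw hx F
  have h1 : ∀ i, HasSum (fun m => ⟪a m, x i⟫_ℂ * ⟪w i, b m⟫_ℂ) ⟪w i, T (x i)⟫_ℂ := fun i => by
    simpa [inner_smul_right] using (h.2 (x i)).mapL (innerSL ℂ (w i))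
  have h2 : ∀ i, Summable (fun m => ‖⟪a m, x i⟫_ℂ‖ * ‖⟪w i, b m⟫_ℂ‖) := fun i => by
    refine h.1.of_nonneg_of_le (fun m => by positivity) fun m => ?_
    have h3 := norm_inner_le_norm (𝕜 := ℂ) (a m) (x i)
    have h4 := norm_inner_le_norm (𝕜 := ℂ) (w i) (b m)
    rw [hx.1 i, mul_one] at h3
    rw [hw.1 i, one_mul] at h4
    gcongr
  calc ∑ i ∈ F, ‖⟪w i, T (x i)⟫_ℂ‖ ≤ ∑ i ∈ F, ∑' m, ‖⟪a m, x i⟫_ℂ‖ * ‖⟪w i, b m⟫_ℂ‖ := by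
        refine Finset.sum_le_sum fun i _ => ?_
        rw [← (h1 i).tsum_eq]
        simp_rw [← norm_mul]
        exact norm_tsum_le_tsum_norm (by simpa only [norm_mul] using h2 i)
    _ = ∑' m, ∑ i ∈ F, ‖⟪a m, x i⟫_ℂ‖ * ‖⟪w i, b m⟫_ℂ‖ :=
        (Summable.tsum_finsetSum fun i _ => h2 i).symm
    _ ≤ _ := by
        refine Summable.tsum_le_tsum (fun m => sum_norm_inner_mul_le hw hx F _ _) ?_ h.1
        exact summable_sum fun i _ => h2 i

theorem TraceBound.add {T T' : H →L[ℂ] H} {C C' : ℝ} (h : TraceBound T C)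
    (h' : TraceBound T' C') : TraceBound (T + T') (C + C') := by
  intro κ w x hw hx F
  refine le_trans ?_ (add_le_add (h w x hw hx F) (h' w x hw hx F))
  rw [← Finset.sum_add_distrib]
  refine Finset.sum_le_sum fun i _ => ?_
  rw [add_apply, inner_add_right]
  exact norm_add_le _ _

theorem TraceBound.smul {T : H →L[ℂ] H} {C : ℝ} (h : TraceBound T C) (c : ℂ) :
    TraceBound (c • T) (‖c‖ * C) := by
  intro κ w x hw hx F
  simp only [smul_apply, inner_smul_right, norm_mul, ← Finset.mul_sum]
  exact mul_le_mul_of_nonneg_left (h w x hw hx F) (norm_nonneg c)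

theorem traceBound_zero : TraceBound (0 : H →L[ℂ] H) 0 := by
  intro κ w x hw hx F
  simp

theorem exists_traceBound_sum {κ : Type*} (F : Finset κ) {T : κ → H →L[ℂ] H}
    (h : ∀ i ∈ F, ∃ C, TraceBound (T i) C) : ∃ C, TraceBound (∑ i ∈ F, T i) C := by
  classical
  induction F using Finset.induction_on with
  | empty => exact ⟨0, by simpa using traceBound_zero⟩
  | insert a s ha ih =>
    obtain ⟨C, hC⟩ := ih fun i hi => h i (Finset.mem_insert_of_mem hi)
    obtain ⟨C', hC'⟩ := h a (Finset.mem_insert_self _ _)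
    exact ⟨_, by rw [Finset.sum_insert ha]; exact hC'.add hC⟩

theorem Schmidt.apply_v {X : H →L[ℂ] H} (S : Schmidt X) (i : S.ι) :
    X (S.v i) = (S.s i : ℂ) • S.f i := by
  classical
  refine (S.hasSum (S.v i)).unique ?_
  have h : ∀ j, ((S.s j : ℂ) * ⟪S.v j, S.v i⟫_ℂ) • S.f j
      = if j = i then (S.s i : ℂ) • S.f i else 0 := fun j => by
    rw [orthonormal_iff_ite.1 S.v_orthonormal j i]
    split_ifs with hj <;> simp [hj]
  simp_rw [h]
  exact hasSum_ite_eq i _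

theorem mem_one_of_traceBound {X : H →L[ℂ] H} (hX : IsCompactOperator X) {C : ℝ} (h : TraceBound X C) :
    Mem 1 X := by
  obtain ⟨S⟩ := exists_schmidt hX
  refine ⟨hX, ?_⟩
  rw [S.posTrace_rpow 1 one_pos]
  have hs : Summable S.s := by
    refine summable_of_sum_le (c := C) (fun i => (S.s_pos i).le) fun F => ?_
    refine le_trans (Finset.sum_le_sum fun i _ => ?_) (h S.f S.v S.f_orthonormal S.v_orthonormal F)
    rw [S.apply_v, inner_smul_right, inner_self_eq_norm_sq_to_K, S.f_orthonormal.1 i]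
    simp [le_abs_self]
  simp only [Real.rpow_one]
  rw [← ENNReal.ofReal_tsum_of_nonneg (fun i => (S.s_pos i).le) hs]
  exact ENNReal.ofReal_lt_top

theorem TraceBound.summable {T : H →L[ℂ] H} {C : ℝ} (h : TraceBound T C) :
    Summable fun e : basisIndex H => ⟪basis H e, T (basis H e)⟫_ℂ := by
  refine Summable.of_norm (summable_of_sum_le (c := C) (fun i => norm_nonneg _) fun F => ?_)
  exact h _ _ (basis H).orthonormal (basis H).orthonormal F

theorem trace_sum {κ : Type*} (F : Finset κ) {T : κ → H →L[ℂ] H}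
    (h : ∀ i ∈ F, ∃ C, TraceBound (T i) C) : trace (∑ i ∈ F, T i) = ∑ i ∈ F, trace (T i) := by
  unfold trace
  rw [← Summable.tsum_finsetSum fun i hi => (h i hi).choose_spec.summable]
  simp

theorem trace_smul (c : ℂ) (T : H →L[ℂ] H) : trace (c • T) = c * trace T := by
  unfold trace
  simp [tsum_mul_left]

/-- Fubini for `⟨aᵢ, e⟩ ⟨e, bᵢ⟩`: summing over `e` first gives `⟨aᵢ, bᵢ⟩`, summing over `i` first
gives `⟨e, T e⟩`. -/
theorem NuclearRep.hasSum_trace {ι : Type*} {T : H →L[ℂ] H} {a b : ι → H}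
    (h : NuclearRep T a b) : HasSum (fun i => ⟪a i, b i⟫_ℂ) (trace T) := by
  set φ : ι × basisIndex H → ℂ := fun p => ⟪a p.1, basis H p.2⟫_ℂ * ⟪basis H p.2, b p.1⟫_ℂ
  have hb := (basis H).orthonormal
  have h0 : ∀ i, Summable fun e => ‖φ (i, e)‖ := fun i => by
    refine summable_of_sum_le (c := ‖a i‖ * ‖b i‖) (fun e => norm_nonneg _) fun F => ?_
    simp only [φ, norm_mul]
    exact sum_norm_inner_mul_le hb hb F _ _
  have hφ : Summable φ := by
    refine Summable.of_norm ((summable_prod_of_nonneg fun p => norm_nonneg _).2 ⟨h0, ?_⟩)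
    refine h.1.of_nonneg_of_le (fun i => tsum_nonneg fun e => norm_nonneg _) fun i => ?_
    refine (h0 i).tsum_le_of_sum_le fun F => ?_
    simp only [φ, norm_mul]
    exact sum_norm_inner_mul_le hb hb F _ _
  have h1 : HasSum (fun i => ⟪a i, b i⟫_ℂ) (∑' p, φ p) :=
    hφ.hasSum.prod_fiberwise fun i => (basis H).hasSum_inner_mul_inner (a i) (b i)
  have h2 : ∑' p, φ p = trace T := by
    rw [← (Equiv.prodComm _ _).tsum_eq φ]
    have hφ' : Summable fun p => φ (Equiv.prodComm (basisIndex H) ι p) :=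
      (Equiv.prodComm _ _).summable_iff.2 hφ
    refine (hφ'.hasSum.prod_fiberwise (g := fun e => ⟪basis H e, T (basis H e)⟫_ℂ) fun e => ?_).tsum_eq.symm
    simpa [inner_smul_right, φ] using (h.2 (basis H e)).mapL (innerSL ℂ (basis H e))
  rwa [h2] at h1

/-! ### Schatten norms via singular values, and products of Schatten operators. -/

theorem Schmidt.summable {X : H →L[ℂ] H} (S : Schmidt X) {p : ℝ} (hp : 0 < p) (h : Mem p X) :
    Summable fun i => S.s i ^ p := by
  have h1 := h.2
  rw [S.posTrace_rpow p hp] at h1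
  have := ENNReal.summable_toReal h1.ne
  refine this.congr fun i => ?_
  rw [ENNReal.toReal_ofReal (Real.rpow_nonneg (S.s_pos i).le _)]

theorem Schmidt.norm_rpow {X : H →L[ℂ] H} (S : Schmidt X) {p : ℝ} (hp : 0 < p) (h : Mem p X) :
    norm p X ^ p = ∑' i, S.s i ^ p := by
  have h0 : ∀ i, 0 ≤ S.s i ^ p := fun i => Real.rpow_nonneg (S.s_pos i).le _
  unfold norm
  rw [S.posTrace_rpow p hp, ← ENNReal.ofReal_tsum_of_nonneg h0 (S.summable hp h),
    ENNReal.toReal_ofReal (tsum_nonneg h0), ← Real.rpow_mul (tsum_nonneg h0),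
    one_div_mul_cancel hp.ne', Real.rpow_one]

theorem schatten_norm_nonneg (p : ℝ) (X : H →L[ℂ] H) : 0 ≤ norm p X :=
  Real.rpow_nonneg ENNReal.toReal_nonneg _

theorem Schmidt.norm_apply_rpow_le {X : H →L[ℂ] H} (S : Schmidt X) {q : ℝ} (hq : 2 ≤ q)
    (h : Mem q X) {x : H} (hx : ‖x‖ = 1) :
    ‖X x‖ ^ q ≤ ∑' j, S.s j ^ q * ‖⟪S.v j, x⟫_ℂ‖ ^ 2 := by
  have hq0 : 0 < q := by linarith
  have hbes : ∀ F : Finset S.ι, ∑ j ∈ F, ‖⟪S.v j, x⟫_ℂ‖ ^ 2 ≤ 1 := fun F => by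
    simpa [hx] using S.v_orthonormal.sum_inner_products_le (s := F) x
  have hle : ∀ j, ‖⟪S.v j, x⟫_ℂ‖ ^ 2 ≤ 1 := fun j => by simpa using hbes {j}
  have hs : Summable fun j => S.s j ^ q * ‖⟪S.v j, x⟫_ℂ‖ ^ 2 := by
    have hs0 : ∀ j, 0 ≤ S.s j ^ q := fun j => Real.rpow_nonneg (S.s_pos j).le _
    exact (S.summable hq0 h).of_nonneg_of_le (fun j => mul_nonneg (hs0 j) (by positivity))
      fun j => mul_le_of_le_one_right (hs0 j) (hle j)
  refine le_of_tendsto ((Filter.Tendsto.norm (S.hasSum x)).rpow_const (Or.inr hq0.le))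
    (Filter.Eventually.of_forall fun F => ?_)
  refine le_trans ?_ (hs.sum_le_tsum F fun j _ =>
    mul_nonneg (Real.rpow_nonneg (S.s_pos j).le _) (by positivity))
  have h1 : ‖∑ j ∈ F, ((S.s j : ℂ) * ⟪S.v j, x⟫_ℂ) • S.f j‖ ^ 2
      = ∑ j ∈ F, ‖⟪S.v j, x⟫_ℂ‖ ^ 2 * S.s j ^ 2 := by
    have := S.f_orthonormal.inner_sum (fun j => (S.s j : ℂ) * ⟪S.v j, x⟫_ℂ)
      (fun j => (S.s j : ℂ) * ⟪S.v j, x⟫_ℂ) F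
    rw [inner_self_eq_norm_sq_to_K] at this
    apply Complex.ofReal_injective
    push_cast
    refine this.trans (Finset.sum_congr rfl fun j _ => ?_)
    rw [← Complex.normSq_eq_conj_mul_self, Complex.normSq_eq_norm_sq, norm_mul]
    rw [Complex.norm_real, Real.norm_eq_abs, mul_pow, sq_abs]
    push_cast
    ring
  -- Power mean inequality with exponent `q / 2 ≥ 1`; by Bessel the weights `|⟨vⱼ, x⟩|²` have total
  -- mass at most one.
  have h2 := Real.inner_le_weight_mul_Lp_of_nonneg F (p := q / 2) (by linarith)
    (fun j => ‖⟪S.v j, x⟫_ℂ‖ ^ 2) (fun j => S.s j ^ 2) (fun j => by positivity)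
    (fun j => by positivity)
  rw [← h1] at h2
  have h3 : ∀ j, (S.s j ^ 2) ^ (q / 2) = S.s j ^ q := fun j => by
    rw [← Real.rpow_natCast, ← Real.rpow_mul (S.s_pos j).le]
    congr 1; push_cast; ring
  simp only [h3] at h2
  set N := ‖∑ j ∈ F, ((S.s j : ℂ) * ⟪S.v j, x⟫_ℂ) • S.f j‖
  set R := ∑ j ∈ F, ‖⟪S.v j, x⟫_ℂ‖ ^ 2 * S.s j ^ q with hR
  have hR0 : 0 ≤ R := Finset.sum_nonneg fun j _ =>
    mul_nonneg (by positivity) (Real.rpow_nonneg (S.s_pos j).le _)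
  have h4 : N ^ 2 ≤ R ^ (q / 2)⁻¹ := by
    refine h2.trans (mul_le_of_le_one_left (Real.rpow_nonneg hR0 _) ?_)
    refine Real.rpow_le_one (Finset.sum_nonneg fun j _ => by positivity) (hbes F) ?_
    rw [sub_nonneg]
    exact inv_le_one_of_one_le₀ (by linarith)
  have h5 : N ^ q ≤ R := by
    have := Real.rpow_le_rpow (by positivity) h4 (by linarith : 0 ≤ q / 2)
    rwa [← Real.rpow_mul hR0, inv_mul_cancel₀ (by linarith), Real.rpow_one, ← Real.rpow_natCast,
      ← Real.rpow_mul (_root_.norm_nonneg _), show ((2 : ℕ) : ℝ) * (q / 2) = q by push_cast; ring] at this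
  refine h5.trans_eq (Finset.sum_congr rfl fun j _ => mul_comm _ _)

/-- Applying `Y` to the expansion of `X` gives the series. It converges absolutely by Young's
inequality, because `∑ ‖Y fᵢ‖ ^ q` is at most the sum of the `q`-th powers of the singular values of
`Y` when `q ≥ 2`. -/
theorem Schmidt.nuclearRep_mul {X Y : H →L[ℂ] H} (S : Schmidt X) {p q : ℝ}
    (hpq : p.HolderConjugate q) (hq : 2 ≤ q) (hX : Mem p X) (hY : Mem q Y) :
    NuclearRep (Y * X) S.v (fun i => (S.s i : ℂ) • Y (S.f i)) := by
  obtain ⟨R⟩ := exists_schmidt hY.1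
  have hq0 : 0 < q := by linarith
  have hR0 : ∀ j, 0 ≤ R.s j ^ q := fun j => Real.rpow_nonneg (R.s_pos j).le _
  have hle : ∀ i j, ‖⟪R.v j, S.f i⟫_ℂ‖ ^ 2 ≤ 1 := fun i j => by
    have := norm_inner_le_norm (𝕜 := ℂ) (R.v j) (S.f i)
    rw [R.v_orthonormal.1, S.f_orthonormal.1, one_mul] at this
    exact pow_le_one₀ (norm_nonneg _) this
  have hsum : ∀ i, Summable fun j => R.s j ^ q * ‖⟪R.v j, S.f i⟫_ℂ‖ ^ 2 := fun i =>
    (R.summable hq0 hY).of_nonneg_of_le (fun j => mul_nonneg (hR0 j) (by positivity))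
      fun j => mul_le_of_le_one_right (hR0 j) (hle i j)
  have hYf : Summable fun i => ‖Y (S.f i)‖ ^ q := by
    refine summable_of_sum_le (c := ∑' j, R.s j ^ q)
      (fun i => Real.rpow_nonneg (norm_nonneg _) _) fun F => ?_
    calc ∑ i ∈ F, ‖Y (S.f i)‖ ^ q
        ≤ ∑ i ∈ F, ∑' j, R.s j ^ q * ‖⟪R.v j, S.f i⟫_ℂ‖ ^ 2 :=
          Finset.sum_le_sum fun i _ => R.norm_apply_rpow_le hq hY (S.f_orthonormal.1 i)
      _ = ∑' j, ∑ i ∈ F, R.s j ^ q * ‖⟪R.v j, S.f i⟫_ℂ‖ ^ 2 :=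
          (Summable.tsum_finsetSum fun i _ => hsum i).symm
      _ ≤ _ := by
          refine Summable.tsum_le_tsum (fun j => ?_) (summable_sum fun i _ => hsum i)
            (R.summable hq0 hY)
          rw [← Finset.mul_sum]
          refine mul_le_of_le_one_right (hR0 j) ?_
          simp_rw [norm_inner_symm (R.v j)]
          simpa [R.v_orthonormal.1 j] using
            S.f_orthonormal.sum_inner_products_le (s := F) (R.v j)
  refine ⟨?_, fun x => ?_⟩
  · refine (((S.summable hpq.pos hX).div_const p).add (hYf.div_const q)).of_nonneg_of_le
      (fun i => by positivity) fun i => ?_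
    rw [S.v_orthonormal.1, one_mul, norm_smul, Complex.norm_real, Real.norm_eq_abs,
      abs_of_pos (S.s_pos i)]
    exact Real.young_inequality_of_nonneg (S.s_pos i).le (norm_nonneg _) hpq
  · have := (S.hasSum x).mapL Y
    simp only [map_smul, ← mul_apply_eq_comp] at this
    simpa only [smul_smul, mul_comm] using this

/-! ### The two endpoint estimates. -/

/-- Coordinatewise complex conjugation with values in `ℓ²`. -/
def conjCoord (x : H) : lp (fun _ : basisIndex H => ℂ) 2 := star ((basis H).repr x)

theorem inner_conjCoord (x y : H) : ⟪conjCoord x, conjCoord y⟫_ℂ = ⟪y, x⟫_ℂ := by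
  rw [← (basis H).repr.inner_map_map y x, lp.inner_eq_tsum, lp.inner_eq_tsum]
  simp [conjCoord, mul_comm]

/-- The tensor `e ⊗ conj f` models the rank one operator `⟨e, ·⟩ f` as a Hilbert–Schmidt vector;
conjugation makes the correspondence compatible with inner products. -/
theorem orthonormal_tmul_conjCoord {ι : Type*} {e f : ι → H} (he : Orthonormal ℂ e)
    (hf : Orthonormal ℂ f) : Orthonormal ℂ fun i => e i ⊗ₜ[ℂ] conjCoord (f i) := by
  classical
  rw [orthonormal_iff_ite] at *
  intro i j
  rw [TensorProduct.inner_tmul, inner_conjCoord, he, hf]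
  by_cases h : i = j <;> simp [h, eq_comm]

variable {K I : Type*} [Fintype K] [Fintype I] {ε : K → I → ℝ} {N : ℝ}

/-- With `C a = ∑ₖ εₖₐ Aₖ`, orthogonality of the rows cancels the cross terms in `∑ ‖C a‖²`;
Cauchy–Schwarz then finishes. -/
theorem norm_sum_inner_le_of_orthogonal_rows [DecidableEq K] {E : Type*} [NormedAddCommGroup E]
    [InnerProductSpace ℂ E] (hrow : ∀ k l, ∑ a, ε k a * ε l a = if k = l then N else 0)
    (A : K → E) (D : I → E) :
    ‖∑ k, ∑ a, (ε k a : ℂ) * ⟪A k, D a⟫_ℂ‖ ≤ √(N * ∑ k, ‖A k‖ ^ 2) * √(∑ a, ‖D a‖ ^ 2) := by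
  set C : I → E := fun a => ∑ k, (ε k a : ℂ) • A k with hC
  have h1 : ∑ k, ∑ a, (ε k a : ℂ) * ⟪A k, D a⟫_ℂ = ∑ a, ⟪C a, D a⟫_ℂ := by
    rw [Finset.sum_comm]
    simp only [hC, sum_inner, inner_smul_left, Complex.conj_ofReal]
  have h2 : ∑ a, ‖C a‖ ^ 2 = N * ∑ k, ‖A k‖ ^ 2 := by
    apply Complex.ofReal_injective
    push_cast
    have h3 : ∀ a, (‖C a‖ : ℂ) ^ 2 = ∑ k, ∑ l, ((ε k a * ε l a : ℝ) : ℂ) * ⟪A k, A l⟫_ℂ := by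
      intro a
      have : (‖C a‖ : ℂ) ^ 2 = ⟪C a, C a⟫_ℂ := by rw [inner_self_eq_norm_sq_to_K]; rfl
      rw [this]
      simp only [hC, sum_inner, inner_sum, inner_smul_left, inner_smul_right, Complex.conj_ofReal]
      rw [Finset.sum_comm]
      refine Finset.sum_congr rfl fun k _ => ?_
      rw [Finset.mul_sum]
      refine Finset.sum_congr rfl fun l _ => ?_
      push_cast
      ring
    simp_rw [h3]
    rw [Finset.sum_comm, Finset.mul_sum]
    refine Finset.sum_congr rfl fun k _ => ?_
    rw [Finset.sum_comm]
    have h4 : ∀ l, ∑ a, ((ε k a * ε l a : ℝ) : ℂ) * ⟪A k, A l⟫_ℂ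
        = if k = l then N * ⟪A k, A k⟫_ℂ else 0 := fun l => by
      rw [← Finset.sum_mul, ← Complex.ofReal_sum, hrow]
      split_ifs with h <;> simp [h]
    simp_rw [h4]
    simp [inner_self_eq_norm_sq_to_K]
  rw [h1, ← h2]
  refine (norm_sum_le _ _).trans (le_trans ?_ (Real.sum_mul_le_sqrt_mul_sqrt _ _ _))
  exact Finset.sum_le_sum fun a _ => norm_inner_le_norm _ _

variable {κ : K → Type*} {l : I → Type*} {e f : ∀ k, κ k → H} {g h : ∀ a, l a → H}

theorem norm_sum_smul_sq {E : Type*} [NormedAddCommGroup E] [InnerProductSpace ℂ E] {ι : Type*}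
    {v : ι → E} (hv : Orthonormal ℂ v) (F : Finset ι) (c : ι → ℂ) :
    ‖∑ m ∈ F, c m • v m‖ ^ 2 = ∑ m ∈ F, ‖c m‖ ^ 2 := by
  have := hv.inner_sum c c F
  rw [inner_self_eq_norm_sq_to_K] at this
  apply Complex.ofReal_injective
  push_cast
  refine this.trans (Finset.sum_congr rfl fun j _ => ?_)
  rw [← Complex.normSq_eq_conj_mul_self, Complex.normSq_eq_norm_sq]
  simp

theorem norm_sum_smul_inner_le [DecidableEq K] {E : Type*} [NormedAddCommGroup E]
    [InnerProductSpace ℂ E] (hrow : ∀ k l, ∑ a, ε k a * ε l a = if k = l then N else 0)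
    {x : ∀ k, κ k → E} {y : ∀ a, l a → E} (hx : ∀ k, Orthonormal ℂ (x k))
    (hy : ∀ a, Orthonormal ℂ (y a)) (F : ∀ k, Finset (κ k)) (G : ∀ a, Finset (l a))
    (u : ∀ k, κ k → ℂ) (w : ∀ a, l a → ℂ) :
    ‖∑ k, ∑ a, (ε k a : ℂ) * ∑ m ∈ F k, ∑ j ∈ G a, u k m * w a j * ⟪x k m, y a j⟫_ℂ‖ ≤
      √(N * ∑ k, ∑ m ∈ F k, ‖u k m‖ ^ 2) * √(∑ a, ∑ j ∈ G a, ‖w a j‖ ^ 2) := by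
  have key := norm_sum_inner_le_of_orthogonal_rows hrow
    (fun k => ∑ m ∈ F k, (starRingEnd ℂ (u k m)) • x k m) (fun a => ∑ j ∈ G a, w a j • y a j)
  simp_rw [norm_sum_smul_sq (hy _)] at key
  simp_rw [norm_sum_smul_sq (hx _), RCLike.norm_conj] at key
  refine le_of_eq_of_le ?_ key
  congr 1
  refine Finset.sum_congr rfl fun k _ => Finset.sum_congr rfl fun a _ => ?_
  simp only [sum_inner, inner_sum, inner_smul_left, inner_smul_right, Complex.conj_conj]
  congr 1
  simp_rw [Finset.mul_sum]
  rw [Finset.sum_comm]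
  refine Finset.sum_congr rfl fun m _ => Finset.sum_congr rfl fun j _ => by ring

/-- The trace of `∑ εₖₐ Yₐ Aₖ`, where `Aₖ = ∑ uₖₘ ⟨eₖₘ, ·⟩ fₖₘ` and `Yₐ = ∑ wₐⱼ ⟨gₐⱼ, ·⟩ hₐⱼ`. -/
def pairing (ε : K → I → ℝ) (e f : ∀ k, κ k → H) (g h : ∀ a, l a → H) (F : ∀ k, Finset (κ k))
    (G : ∀ a, Finset (l a)) (u : ∀ k, κ k → ℂ) (w : ∀ a, l a → ℂ) : ℂ :=
  ∑ k, ∑ a, (ε k a : ℂ) * ∑ m ∈ F k, ∑ j ∈ G a,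
    u k m * w a j * (⟪e k m, h a j⟫_ℂ * ⟪g a j, f k m⟫_ℂ)

theorem norm_pairing_le_two [DecidableEq K]
    (hrow : ∀ k l, ∑ a, ε k a * ε l a = if k = l then N else 0)
    (he : ∀ k, Orthonormal ℂ (e k)) (hf : ∀ k, Orthonormal ℂ (f k))
    (hg : ∀ a, Orthonormal ℂ (g a)) (hh : ∀ a, Orthonormal ℂ (h a)) (F : ∀ k, Finset (κ k))
    (G : ∀ a, Finset (l a)) (u : ∀ k, κ k → ℂ) (w : ∀ a, l a → ℂ) :
    ‖pairing ε e f g h F G u w‖ ≤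
      √(N * ∑ k, ∑ m ∈ F k, ‖u k m‖ ^ 2) * √(∑ a, ∑ j ∈ G a, ‖w a j‖ ^ 2) := by
  have key := norm_sum_smul_inner_le hrow (fun k => orthonormal_tmul_conjCoord (he k) (hf k))
    (fun a => orthonormal_tmul_conjCoord (hh a) (hg a)) F G u w
  simpa only [pairing, TensorProduct.inner_tmul, inner_conjCoord] using key

theorem norm_pairing_le_one (hε : ∀ k a, |ε k a| ≤ 1)
    (he : ∀ k, Orthonormal ℂ (e k)) (hf : ∀ k, Orthonormal ℂ (f k))
    (hg : ∀ a, Orthonormal ℂ (g a)) (hh : ∀ a, Orthonormal ℂ (h a)) (F : ∀ k, Finset (κ k))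
    (G : ∀ a, Finset (l a)) (u : ∀ k, κ k → ℂ) (w : ∀ a, l a → ℂ) {M : I → ℝ}
    (hM : ∀ a, 0 ≤ M a) (hw : ∀ a, ∀ j ∈ G a, ‖w a j‖ ≤ M a) :
    ‖pairing ε e f g h F G u w‖ ≤ (∑ k, ∑ m ∈ F k, ‖u k m‖) * ∑ a, M a := by
  unfold pairing
  rw [Finset.sum_mul]
  refine (norm_sum_le _ _).trans (Finset.sum_le_sum fun k _ => ?_)
  rw [Finset.mul_sum]
  refine (norm_sum_le _ _).trans (Finset.sum_le_sum fun a _ => ?_)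
  rw [norm_mul, Complex.norm_real, Real.norm_eq_abs]
  refine (mul_le_of_le_one_left (norm_nonneg _) (hε k a)).trans ?_
  rw [Finset.sum_mul]
  refine (norm_sum_le _ _).trans (Finset.sum_le_sum fun m _ => ?_)
  simp_rw [mul_assoc, ← Finset.mul_sum]
  rw [norm_mul]
  refine mul_le_mul_of_nonneg_left ?_ (norm_nonneg _)
  calc ‖∑ j ∈ G a, w a j * (⟪e k m, h a j⟫_ℂ * ⟪g a j, f k m⟫_ℂ)‖
      ≤ ∑ j ∈ G a, M a * (‖⟪e k m, h a j⟫_ℂ‖ * ‖⟪g a j, f k m⟫_ℂ‖) := by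
        refine (norm_sum_le _ _).trans (Finset.sum_le_sum fun j hj => ?_)
        rw [norm_mul, norm_mul]
        exact mul_le_mul_of_nonneg_right (hw a j hj) (by positivity)
    _ ≤ M a * 1 := by
        rw [← Finset.mul_sum]
        refine mul_le_mul_of_nonneg_left ?_ (hM a)
        simpa [(he k).1, (hf k).1] using
          sum_norm_inner_mul_le (hg a) (hh a) (G a) (e k m) (f k m)
    _ = M a := mul_one _

/-! ### Complex interpolation. -/

theorem exists_norm_sum_le {ι X : Type*} (F : Finset ι) (φ : ι → X → ℂ) (S : Set X)
    (hφ : ∀ i ∈ F, ∃ C, ∀ z ∈ S, ‖φ i z‖ ≤ C) : ∃ C, ∀ z ∈ S, ‖∑ i ∈ F, φ i z‖ ≤ C := by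
  choose! C hC using hφ
  exact ⟨∑ i ∈ F, C i, fun z hz =>
    (norm_sum_le _ _).trans (Finset.sum_le_sum fun i hi => hC i hi z hz)⟩

theorem exists_norm_exp_le (a b : ℝ) :
    ∃ C, ∀ z ∈ Complex.HadamardThreeLines.verticalClosedStrip 0 1,
      ‖Complex.exp (a + b * z)‖ ≤ C := by
  refine ⟨Real.exp (|a| + |b|), fun z hz => ?_⟩
  rw [Complex.norm_exp]
  simp only [Complex.add_re, Complex.ofReal_re, Complex.re_ofReal_mul]
  have h1 : z.re ∈ Set.Icc (0 : ℝ) 1 := hz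
  have h2 : b * z.re ≤ |b| := by
    calc b * z.re ≤ |b| * z.re := mul_le_mul_of_nonneg_right (le_abs_self b) h1.1
      _ ≤ |b| := mul_le_of_le_one_right (abs_nonneg b) h1.2
  exact Real.exp_le_exp.2 (add_le_add (le_abs_self a) h2)

theorem norm_pairing_le [DecidableEq K] (hN : 0 ≤ N) (hε : ∀ k a, |ε k a| ≤ 1)
    (hrow : ∀ k l, ∑ a, ε k a * ε l a = if k = l then N else 0)
    (he : ∀ k, Orthonormal ℂ (e k)) (hf : ∀ k, Orthonormal ℂ (f k))
    (hg : ∀ a, Orthonormal ℂ (g a)) (hh : ∀ a, Orthonormal ℂ (h a)) (F : ∀ k, Finset (κ k))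
    (G : ∀ a, Finset (l a)) {p q : ℝ} (hpq : p.HolderConjugate q) (hq : 2 ≤ q)
    {s : ∀ k, κ k → ℝ} {t : ∀ a, l a → ℝ} (hs : ∀ k m, 0 < s k m) (ht : ∀ a j, 0 < t a j)
    {τ : I → ℝ} (hτ : ∀ a, 0 < τ a) (htτ : ∀ a, ∑ j ∈ G a, t a j ^ q ≤ τ a ^ q) :
    ‖pairing ε e f g h F G (fun k m => (s k m : ℂ)) (fun a j => (t a j : ℂ))‖ ≤
      N ^ (1 / q) * (∑ k, ∑ m ∈ F k, s k m ^ p) ^ (1 / p) * (∑ a, τ a ^ p) ^ (1 / p) := by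
  have hq0 : 0 < q := by linarith
  have hp0 : 0 < p := hpq.pos
  have hpq' : p * (1 - 1 / q) = 1 := by
    have := hpq.inv_add_inv_eq_one
    have h2 : 1 - 1 / q = p⁻¹ := by rw [one_div]; linarith
    rw [h2, mul_inv_cancel₀ hp0.ne']
  -- `U z = s ^ (p (1 - z/2))` and `W z = τ ^ (p (1 - z/2) - q z/2) t ^ (q z/2)`, so that `z = 2 /
  -- q` returns `s` and `t`. On `Re z = 0` the moduli are `s ^ p` and `τ ^ p`; on `Re z = 1` their
  -- squares are `s ^ p` and `τ ^ (p - q) t ^ q`.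
  set U : ℂ → ∀ k, κ k → ℂ := fun z k m =>
    Complex.exp ((p * Real.log (s k m) : ℝ) + (-(p / 2) * Real.log (s k m) : ℝ) * z) with hU
  set W : ℂ → ∀ a, l a → ℂ := fun z a j =>
    Complex.exp ((p * Real.log (τ a) : ℝ) +
      (-(p / 2) * Real.log (τ a) - q / 2 * Real.log (τ a) + q / 2 * Real.log (t a j) : ℝ) * z)
    with hW
  have hUn : ∀ z k m, ‖U z k m‖ = s k m ^ (p * (1 - z.re / 2)) := fun z k m => by
    rw [hU, Complex.norm_exp, Real.rpow_def_of_pos (hs k m)]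
    simp only [Complex.add_re, Complex.ofReal_re, Complex.re_ofReal_mul]
    congr 1; ring
  have hWn : ∀ z a j, ‖W z a j‖ =
      τ a ^ (p * (1 - z.re / 2) - q * z.re / 2) * t a j ^ (q * z.re / 2) := fun z a j => by
    rw [hW, Complex.norm_exp, Real.rpow_def_of_pos (hτ a), Real.rpow_def_of_pos (ht a j),
      ← Real.exp_add]
    simp only [Complex.add_re, Complex.ofReal_re, Complex.re_ofReal_mul]
    congr 1; ring
  set Φ : ℂ → ℂ := fun z => pairing ε e f g h F G (U z) (W z) with hΦ
  set a := ∑ k, ∑ m ∈ F k, s k m ^ p with ha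
  set b := ∑ a, τ a ^ p with hb
  have ha0 : 0 ≤ a := Finset.sum_nonneg fun k _ => Finset.sum_nonneg fun m _ =>
    Real.rpow_nonneg (hs k m).le _
  have hb0 : 0 ≤ b := Finset.sum_nonneg fun i _ => Real.rpow_nonneg (hτ i).le _
  have hdiff : Differentiable ℂ Φ := by
    simp only [hΦ, pairing, hU, hW]
    fun_prop
  have hbdd : ∃ C, ∀ z ∈ Complex.HadamardThreeLines.verticalClosedStrip 0 1, ‖Φ z‖ ≤ C := by
    simp only [hΦ, pairing, Finset.mul_sum]
    refine exists_norm_sum_le _ _ _ fun k _ => exists_norm_sum_le _ _ _ fun i _ =>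
      exists_norm_sum_le _ _ _ fun m _ => exists_norm_sum_le _ _ _ fun j _ => ?_
    obtain ⟨C, hC⟩ := exists_norm_exp_le (p * Real.log (s k m)) (-(p / 2) * Real.log (s k m))
    obtain ⟨C', hC'⟩ := exists_norm_exp_le (p * Real.log (τ i))
      (-(p / 2) * Real.log (τ i) - q / 2 * Real.log (τ i) + q / 2 * Real.log (t i j))
    refine ⟨‖(ε k i : ℂ)‖ * (C * C' * ‖⟪e k m, h i j⟫_ℂ * ⟪g i j, f k m⟫_ℂ‖), fun z hz => ?_⟩
    rw [norm_mul, norm_mul, norm_mul (U z k m)]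
    have h1 := hC z hz
    have h2 := hC' z hz
    have h3 := (norm_nonneg _).trans h1
    gcongr
  have h0 : ∀ z ∈ Complex.re ⁻¹' {(0 : ℝ)}, ‖Φ z‖ ≤ a * b := by
    intro z hz
    have hz : z.re = 0 := hz
    refine (norm_pairing_le_one hε he hf hg hh F G _ _ (M := fun a => τ a ^ p)
      (fun i => Real.rpow_nonneg (hτ i).le _) fun i j _ => ?_).trans_eq ?_
    · simp [hWn, hz]
    · simp [hUn, hz, ha, hb]
  have h1 : ∀ z ∈ Complex.re ⁻¹' {(1 : ℝ)}, ‖Φ z‖ ≤ √(N * a) * √b := by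
    intro z hz
    have hz : z.re = 1 := hz
    refine (norm_pairing_le_two hrow he hf hg hh F G _ _).trans ?_
    have hU2 : ∀ k m, ‖U z k m‖ ^ 2 = s k m ^ p := fun k m => by
      rw [hUn, hz, ← Real.rpow_natCast, ← Real.rpow_mul (hs k m).le]
      congr 1; push_cast; ring
    have hW2 : ∀ i j, ‖W z i j‖ ^ 2 = τ i ^ (p - q) * t i j ^ q := fun i j => by
      rw [hWn, hz, mul_pow, ← Real.rpow_natCast, ← Real.rpow_mul (hτ i).le, ← Real.rpow_natCast,
        ← Real.rpow_mul (ht i j).le]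
      congr 2 <;> (push_cast; ring)
    simp_rw [hU2, hW2, ← Finset.mul_sum]
    gcongr
    refine Finset.sum_le_sum fun i _ => ?_
    calc τ i ^ (p - q) * ∑ j ∈ G i, t i j ^ q ≤ τ i ^ (p - q) * τ i ^ q :=
          mul_le_mul_of_nonneg_left (htτ i) (Real.rpow_nonneg (hτ i).le _)
      _ = τ i ^ p := by rw [← Real.rpow_add (hτ i), sub_add_cancel]
  have hθ : ((2 / q : ℝ) : ℂ) ∈ Complex.HadamardThreeLines.verticalClosedStrip 0 1 := by
    refine ⟨by simp; positivity, ?_⟩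
    rw [Complex.ofReal_re]
    exact (div_le_one hq0).2 hq
  have key := Complex.HadamardThreeLines.norm_le_interp_of_mem_verticalClosedStrip₀₁' Φ hθ
    hdiff.diffContOnCl (by
      obtain ⟨C, hC⟩ := hbdd
      exact ⟨C, by rintro _ ⟨z, hz, rfl⟩; exact hC z hz⟩) h0 h1
  have hUθ : U (2 / q : ℝ) = fun k m => (s k m : ℂ) := by
    funext k m
    rw [hU]
    simp only [← Complex.ofReal_mul, ← Complex.ofReal_add, ← Complex.ofReal_exp]
    congr 1
    rw [show p * Real.log (s k m) + -(p / 2) * Real.log (s k m) * (2 / q)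
      = p * (1 - 1 / q) * Real.log (s k m) by ring, hpq', one_mul, Real.exp_log (hs k m)]
  have hWθ : W (2 / q : ℝ) = fun i j => (t i j : ℂ) := by
    funext i j
    rw [hW]
    simp only [← Complex.ofReal_mul, ← Complex.ofReal_add, ← Complex.ofReal_exp]
    congr 1
    rw [show p * Real.log (τ i) + (-(p / 2) * Real.log (τ i) - q / 2 * Real.log (τ i) +
        q / 2 * Real.log (t i j)) * (2 / q)
      = (p * (1 - 1 / q) - q / q) * Real.log (τ i) + q / q * Real.log (t i j) by ring, hpq',
      div_self hq0.ne', sub_self, zero_mul, zero_add, one_mul, Real.exp_log (ht i j)]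
  simp only [hΦ, hUθ, hWθ, Complex.ofReal_re] at key
  refine key.trans_eq ?_
  have h2 : (1 : ℝ) - 1 / q = 1 / p := by
    have := hpq.inv_add_inv_eq_one
    rw [one_div, one_div]; linarith
  rw [Real.sqrt_eq_rpow, Real.sqrt_eq_rpow, Real.mul_rpow (Real.rpow_nonneg (mul_nonneg hN ha0) _)
    (Real.rpow_nonneg hb0 _), ← Real.rpow_mul (mul_nonneg hN ha0), ← Real.rpow_mul hb0,
    Real.mul_rpow ha0 hb0, show 1 / 2 * (2 / q) = 1 / q by ring, Real.mul_rpow hN ha0]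
  -- Since `x` may vanish, adding exponents needs both to be nonnegative, which is where `q ≥ 2`
  -- enters.
  have h3 : ∀ x : ℝ, 0 ≤ x → x ^ (1 - 2 / q) * x ^ (1 / q) = x ^ (1 / p) := fun x hx => by
    rw [← h2, ← Real.rpow_add_of_nonneg hx _ (by positivity)]
    · congr 1; ring
    · rw [sub_nonneg]; exact (div_le_one hq0).2 hq
  rw [← h3 a ha0, ← h3 b hb0]
  ring

/-! ### From finite truncations to the trace. -/

theorem isCompactOperator_sum {κ : Type*} (F : Finset κ) {T : κ → H →L[ℂ] H}
    (h : ∀ i ∈ F, IsCompactOperator (T i)) : IsCompactOperator (∑ i ∈ F, T i : H →L[ℂ] H) := by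
  classical
  induction F using Finset.induction_on with
  | empty => simpa using isCompactOperator_zero
  | insert a s ha ih =>
    rw [Finset.sum_insert ha]
    exact (h a (Finset.mem_insert_self _ _)).add
      (ih fun i hi => h i (Finset.mem_insert_of_mem hi))

theorem tendsto_sum_of_hasSum {ι : Type*} {φ : ι → ℂ} {x : ℂ} (h : HasSum φ x) :
    Tendsto (fun F : Finset ι => ∑ i ∈ F, φ i) atTop (𝓝 x) := by
  simpa [HasSum] using h

theorem tendsto_pairing {A : K → H →L[ℂ] H} {Y : I → H →L[ℂ] H} (S : ∀ k, Schmidt (A k))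
    (R : ∀ a, Schmidt (Y a)) (F : ∀ k, Finset (S k).ι) :
    Tendsto (fun G => pairing ε (fun k => (S k).v) (fun k => (S k).f) (fun a => (R a).v)
      (fun a => (R a).f) F G (fun k m => ((S k).s m : ℂ)) (fun a j => ((R a).s j : ℂ)))
      (Filter.pi fun _ => atTop)
      (𝓝 (∑ k, ∑ a, (ε k a : ℂ) *
        ∑ m ∈ F k, ⟪(S k).v m, ((S k).s m : ℂ) • Y a ((S k).f m)⟫_ℂ)) := by
  unfold pairing
  refine tendsto_finsetSum _ fun k _ => tendsto_finsetSum _ fun a _ =>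
    Tendsto.const_mul _ (tendsto_finsetSum _ fun m _ => ?_)
  have h1 : HasSum (fun j => ((S k).s m : ℂ) * (R a).s j *
      (⟪(S k).v m, (R a).f j⟫_ℂ * ⟪(R a).v j, (S k).f m⟫_ℂ))
      ⟪(S k).v m, ((S k).s m : ℂ) • Y a ((S k).f m)⟫_ℂ := by
    have := (((R a).hasSum ((S k).f m)).mapL (innerSL ℂ ((S k).v m))).mul_left ((S k).s m : ℂ)
    simp only [innerSL_apply_apply, inner_smul_right] at this ⊢
    refine this.congr_fun fun j => ?_
    ring
  exact (tendsto_sum_of_hasSum h1).comp (tendsto_eval_pi _ a)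

theorem tendsto_trace {p q : ℝ} (hpq : p.HolderConjugate q) (hq : 2 ≤ q) {A : K → H →L[ℂ] H}
    {Y : I → H →L[ℂ] H} (hA : ∀ k, Mem p (A k)) (hY : ∀ a, Mem q (Y a))
    (S : ∀ k, Schmidt (A k)) :
    Tendsto (fun F : ∀ k, Finset (S k).ι => ∑ k, ∑ a, (ε k a : ℂ) *
        ∑ m ∈ F k, ⟪(S k).v m, ((S k).s m : ℂ) • Y a ((S k).f m)⟫_ℂ)
      (Filter.pi fun _ => atTop)
      (𝓝 (trace (∑ k, ∑ a, (ε k a : ℂ) • (Y a * A k)))) := by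
  have hrep := fun k a => (S k).nuclearRep_mul hpq hq (hA k) (hY a)
  have hb : ∀ k a, ∃ C, TraceBound ((ε k a : ℂ) • (Y a * A k)) C := fun k a =>
    ⟨_, (hrep k a).traceBound.smul _⟩
  rw [trace_sum _ fun k _ => exists_traceBound_sum _ fun a _ => hb k a]
  simp_rw [trace_sum _ fun a _ => hb _ a, trace_smul]
  refine tendsto_finsetSum _ fun k _ => tendsto_finsetSum _ fun a _ => Tendsto.const_mul _ ?_
  exact (tendsto_sum_of_hasSum (hrep k a).hasSum_trace).comp (tendsto_eval_pi _ k)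

theorem mem_one_sum_smul_mul {p q : ℝ} (hpq : p.HolderConjugate q) (hq : 2 ≤ q)
    {A : K → H →L[ℂ] H} {Y : I → H →L[ℂ] H} (hA : ∀ k, Mem p (A k)) (hY : ∀ a, Mem q (Y a)) :
    Mem 1 (∑ k, ∑ a, (ε k a : ℂ) • (Y a * A k)) := by
  have hb : ∀ k a, ∃ C, TraceBound ((ε k a : ℂ) • (Y a * A k)) C := fun k a => by
    obtain ⟨S⟩ := exists_schmidt (hA k).1
    exact ⟨_, (S.nuclearRep_mul hpq hq (hA k) (hY a)).traceBound.smul _⟩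
  obtain ⟨C, hC⟩ := exists_traceBound_sum Finset.univ fun k _ =>
    exists_traceBound_sum Finset.univ fun a _ => hb k a
  refine mem_one_of_traceBound ?_ hC
  exact isCompactOperator_sum _ fun k _ => isCompactOperator_sum _ fun a _ =>
    ((hA k).1.clm_comp (Y a)).smul (ε k a : ℂ)

theorem norm_trace_sum_smul_mul_le [DecidableEq K] (hN : 0 ≤ N) (hε : ∀ k a, |ε k a| ≤ 1)
    (hrow : ∀ k l, ∑ a, ε k a * ε l a = if k = l then N else 0)
    {p q : ℝ} (hpq : p.HolderConjugate q) (hq : 2 ≤ q) {A : K → H →L[ℂ] H} {Y : I → H →L[ℂ] H}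
    (hA : ∀ k, Mem p (A k)) (hY : ∀ a, Mem q (Y a)) :
    ‖trace (∑ k, ∑ a, (ε k a : ℂ) • (Y a * A k))‖ ≤
      N ^ (1 / q) * (∑ k, norm p (A k) ^ p) ^ (1 / p) * (∑ a, norm q (Y a) ^ p) ^ (1 / p) := by
  have hp0 : 0 < p := hpq.pos
  have hq0 : 0 < q := by linarith
  have S : ∀ k, Schmidt (A k) := fun k => (exists_schmidt (hA k).1).some
  have R : ∀ a, Schmidt (Y a) := fun a => (exists_schmidt (hY a).1).some
  -- Interpolation takes logarithms of `τ`, while `norm q (Y a)` may be zero; hence the shift by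
  -- `δ`, removed by a limit at the end.
  have hδ : ∀ δ : ℝ, 0 < δ → ‖trace (∑ k, ∑ a, (ε k a : ℂ) • (Y a * A k))‖ ≤
      N ^ (1 / q) * (∑ k, norm p (A k) ^ p) ^ (1 / p) *
        (∑ a, (norm q (Y a) + δ) ^ p) ^ (1 / p) := by
    intro δ hδ
    refine le_of_tendsto (tendsto_trace hpq hq hA hY S).norm (Eventually.of_forall fun F => ?_)
    -- The limits are iterated: `G` grows with `F` fixed, so no joint convergence is needed.
    refine le_of_tendsto (tendsto_pairing S R F).norm (Eventually.of_forall fun G => ?_)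
    have hn : ∀ a, 0 ≤ norm q (Y a) := fun a => schatten_norm_nonneg q (Y a)
    refine (norm_pairing_le hN hε hrow (fun k => (S k).v_orthonormal)
      (fun k => (S k).f_orthonormal) (fun a => (R a).v_orthonormal) (fun a => (R a).f_orthonormal)
      F G hpq hq (fun k => (S k).s_pos) (fun a => (R a).s_pos)
      (τ := fun a => norm q (Y a) + δ) (fun a => by linarith [hn a]) fun a => ?_).trans ?_
    · calc ∑ j ∈ G a, (R a).s j ^ q ≤ ∑' j, (R a).s j ^ q :=
            ((R a).summable hq0 (hY a)).sum_le_tsum _ fun j _ =>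
              Real.rpow_nonneg ((R a).s_pos j).le _
        _ = norm q (Y a) ^ q := ((R a).norm_rpow hq0 (hY a)).symm
        _ ≤ _ := Real.rpow_le_rpow (hn a) (by linarith) hq0.le
    · have h1 : ∑ k, ∑ m ∈ F k, (S k).s m ^ p ≤ ∑ k, norm p (A k) ^ p :=
        Finset.sum_le_sum fun k _ => by
          rw [(S k).norm_rpow hp0 (hA k)]
          exact ((S k).summable hp0 (hA k)).sum_le_tsum _ fun j _ =>
            Real.rpow_nonneg ((S k).s_pos j).le _
      have h2 : 0 ≤ ∑ k, ∑ m ∈ F k, (S k).s m ^ p := Finset.sum_nonneg fun k _ =>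
        Finset.sum_nonneg fun m _ => Real.rpow_nonneg ((S k).s_pos m).le _
      have h3 : 0 ≤ ∑ a, (norm q (Y a) + δ) ^ p := Finset.sum_nonneg fun a _ =>
        Real.rpow_nonneg (by linarith [hn a]) _
      gcongr
  have hlim : Tendsto (fun δ : ℝ => N ^ (1 / q) * (∑ k, norm p (A k) ^ p) ^ (1 / p) *
        (∑ a, (norm q (Y a) + δ) ^ p) ^ (1 / p)) (𝓝[>] 0)
      (𝓝 (N ^ (1 / q) * (∑ k, norm p (A k) ^ p) ^ (1 / p) *
        (∑ a, norm q (Y a) ^ p) ^ (1 / p))) := by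
    refine Tendsto.const_mul _ (Tendsto.rpow_const ?_ (Or.inr (by positivity)))
    refine tendsto_finsetSum _ fun a _ => Tendsto.rpow_const ?_ (Or.inr hp0.le)
    have : Tendsto (fun δ : ℝ => norm q (Y a) + δ) (𝓝 0) (𝓝 (norm q (Y a) + 0)) :=
      tendsto_const_nhds.add tendsto_id
    rw [add_zero] at this
    exact this.mono_left nhdsWithin_le_nhds
  exact ge_of_tendsto hlim (eventually_mem_nhdsWithin.mono fun δ hδ' => hδ δ hδ')

/-! ### The coefficient matrix and the conclusion. -/

/-- The coefficients of `A₁, …, Aₙ` in `∑ Aₖ` and in the differences `Aᵢ - Aⱼ`, `i < j`. -/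
def clarksonCoeff (n : ℕ) (k : Fin n) : Option (Σ i : Fin n, Finset.Ioi i) → ℝ
  | none => 1
  | some ⟨i, j⟩ => (if k = i then 1 else 0) - (if k = j then 1 else 0)

theorem abs_clarksonCoeff_le (n : ℕ) (k : Fin n) (a) : |clarksonCoeff n k a| ≤ 1 := by
  rcases a with _ | ⟨i, j⟩
  · simp [clarksonCoeff]
  · simp only [clarksonCoeff]
    split_ifs <;> simp

theorem sum_option_sigma_Ioi {n : ℕ} {M : Type*} [AddCommMonoid M]
    (φ : Option (Σ i : Fin n, Finset.Ioi i) → M) (ψ : Fin n → Fin n → M)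
    (h : ∀ i (j : Finset.Ioi i), φ (some ⟨i, j⟩) = ψ i j) :
    ∑ a, φ a = φ none + ∑ i, ∑ j ∈ Finset.Ioi i, ψ i j := by
  rw [Fintype.sum_option, Fintype.sum_sigma]
  simp_rw [h]
  congr 1
  exact Finset.sum_congr rfl fun i _ => Finset.sum_coe_sort _ _

theorem two_mul_sum_Ioi {n : ℕ} (φ : Fin n → Fin n → ℝ) (hsymm : ∀ i j, φ i j = φ j i)
    (hdiag : ∀ i, φ i i = 0) :
    2 * ∑ i, ∑ j ∈ Finset.Ioi i, φ i j = ∑ i, ∑ j, φ i j := by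
  have h1 : ∑ i, ∑ j ∈ Finset.Ioi i, φ i j = ∑ i, ∑ j, if i < j then φ i j else 0 := by
    refine Finset.sum_congr rfl fun i _ => ?_
    rw [← Finset.sum_filter]
    congr 1
    ext j
    simp
  have h2 : ∑ i, ∑ j ∈ Finset.Ioi i, φ i j = ∑ i, ∑ j, if j < i then φ i j else 0 := by
    rw [h1, Finset.sum_comm]
    simp_rw [hsymm]
  rw [two_mul]
  nth_rewrite 1 [h1]
  rw [h2, ← Finset.sum_add_distrib]
  refine Finset.sum_congr rfl fun i _ => ?_
  rw [← Finset.sum_add_distrib]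
  refine Finset.sum_congr rfl fun j _ => ?_
  rcases lt_trichotomy i j with h | h | h
  · simp [h, h.not_gt]
  · simp [h, hdiag]
  · simp [h, h.not_gt]

/-- The sum contributes `1`. If `k = l`, the `n - 1` pairs containing `k` contribute `1` each;
otherwise only the pair `{k, l}` counts, with `-1`. The computation runs over all ordered pairs,
hence the factor two. -/
theorem sum_clarksonCoeff_mul (n : ℕ) (k l : Fin n) :
    ∑ a, clarksonCoeff n k a * clarksonCoeff n l a = if k = l then (n : ℝ) else 0 := by
  rw [sum_option_sigma_Ioi _ (fun i j => ((if k = i then (1 : ℝ) else 0) - (if k = j then 1 else 0)) *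
    ((if l = i then 1 else 0) - (if l = j then 1 else 0))) fun i j => rfl]
  have h := two_mul_sum_Ioi (fun i j => ((if k = i then (1 : ℝ) else 0) - (if k = j then 1 else 0)) *
    ((if l = i then 1 else 0) - (if l = j then 1 else 0))) (fun i j => by ring) (fun i => by simp)
  have h2 : ∑ i : Fin n, ∑ j : Fin n,
      ((if k = i then (1 : ℝ) else 0) - (if k = j then 1 else 0)) *
      ((if l = i then 1 else 0) - (if l = j then 1 else 0))
      = 2 * (if k = l then (n : ℝ) else 0) - 2 := by
    simp only [sub_mul, mul_sub, Finset.sum_sub_distrib]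
    by_cases hkl : k = l
    · subst hkl
      simp
      ring
    · simp [hkl]
      ring
  rw [h2] at h
  simp only [clarksonCoeff]
  linarith

theorem sum_clarksonCoeff_smul {n : ℕ} (A : Fin n → H →L[ℂ] H) (i : Fin n) (j : Finset.Ioi i) :
    ∑ k, (clarksonCoeff n k (some ⟨i, j⟩) : ℂ) • A k = A i - A j := by
  simp [clarksonCoeff, sub_smul, Finset.sum_sub_distrib, ite_smul, apply_ite Complex.ofReal]

end Schatten

end

theorem lemma2p2 {H : Type*} [NormedAddCommGroup H] [InnerProductSpace ℂ H] [CompleteSpace H]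
    [TopologicalSpace.SeparableSpace H]
    (p q : ℝ) (hp1 : 1 < p) (hp2 : p ≤ 2) (hpq : 1 / p + 1 / q = 1)
    (n : ℕ) (A : Fin n → H →L[ℂ] H) (hA : ∀ k, Schatten.Mem p (A k))
    (Y : H →L[ℂ] H) (hY : Schatten.Mem q Y)
    (Y' : Fin n → Fin n → H →L[ℂ] H) (hY' : ∀ i j, i < j → Schatten.Mem q (Y' i j)) :
    Schatten.Mem 1 (Y * ∑ k, A k + ∑ i, ∑ j ∈ Finset.Ioi i, Y' i j * (A i - A j)) ∧
    ‖Schatten.trace (Y * ∑ k, A k + ∑ i, ∑ j ∈ Finset.Ioi i, Y' i j * (A i - A j))‖ ≤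
      (n : ℝ) ^ (1 / q) * (∑ k, Schatten.norm p (A k) ^ p) ^ (1 / p) *
        (Schatten.norm q Y ^ p + ∑ i, ∑ j ∈ Finset.Ioi i, Schatten.norm q (Y' i j) ^ p) ^
          (1 / p) := by
  have hconj : p.HolderConjugate q := by
    rw [Real.holderConjugate_iff]
    exact ⟨hp1, by simpa only [one_div] using hpq⟩
  have hq : 2 ≤ q := by
    have h1 : 1 / 2 ≤ 1 / p := one_div_le_one_div_of_le (by linarith) hp2
    have h2 : 1 / q ≤ 1 / 2 := by linarith
    exact (one_div_le_one_div hconj.symm.pos two_pos).1 h2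
  let Z : Option (Σ i : Fin n, Finset.Ioi i) → H →L[ℂ] H := fun a =>
    a.elim Y fun x => Y' x.1 x.2
  have hZ : ∀ a, Schatten.Mem q (Z a) := by
    rintro (_ | ⟨i, j⟩)
    · exact hY
    · exact hY' i j (Finset.mem_Ioi.1 j.2)
  have hT : Y * ∑ k, A k + ∑ i, ∑ j ∈ Finset.Ioi i, Y' i j * (A i - A j)
      = ∑ k, ∑ a, (Schatten.clarksonCoeff n k a : ℂ) • (Z a * A k) := by
    -- With `a` outermost, the inner sum over `k` collapses to `Y B` for `none` and to `Yᵢⱼ (Aᵢ -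
    -- Aⱼ)` for a pair.
    rw [Finset.sum_comm, Schatten.sum_option_sigma_Ioi _ (fun i j => Y' i j * (A i - A j))]
    · simp [Z, Schatten.clarksonCoeff, Finset.mul_sum]
    · intro i j
      simp_rw [← Schatten.sum_clarksonCoeff_smul A i j, Finset.mul_sum, mul_smul_comm]
      rfl
  have hS : ∑ a, Schatten.norm q (Z a) ^ p = Schatten.norm q Y ^ p +
      ∑ i, ∑ j ∈ Finset.Ioi i, Schatten.norm q (Y' i j) ^ p :=
    Schatten.sum_option_sigma_Ioi _ (fun i j => Schatten.norm q (Y' i j) ^ p) fun _ _ => rfl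
  rw [hT, ← hS]
  exact ⟨Schatten.mem_one_sum_smul_mul hconj hq hA hZ,
    Schatten.norm_trace_sum_smul_mul_le n.cast_nonneg (Schatten.abs_clarksonCoeff_le n)
      (Schatten.sum_clarksonCoeff_mul n) hconj hq hA hZ⟩
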